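/- Let $K$ be a field of characteristic $0$ and let $(\mathcal A,A,A')$ be a quasi-twilled associative algebra over $K$: $\mathcal A$ is an associative (not necessarily unital) $K$-algebra with a decomposition $\mathcal A=A\oplus A'$ into subspaces such that $A'$ is a subalgebra. Write the multiplication of $\mathcal A$ as $\Omega=\pi+\xi+\eta+\beta+\rho+\mu+\theta$, that is, for $x,y\in A$ and $u,v\in A'$, $$(x+u)(y+v)=\big(\pi(x,y)+\xi(x,v)+\eta(u,y)\big)+\big(\beta(u,v)+\rho(x,v)+\mu(u,y)+\theta(x,y)\big),$$ where the first bracket lies in $A$ and the second in $A'$. A linear map $B:A'\to A$ is a left deformation map if for all $u,v\in A'$ $$\pi(Bu,Bv)+\xi(Bu,v)+\eta(u,Bv)=B\big(\beta(u,v)+\rho(Bu,v)+\mu(u,Bv)+\theta(Bu,Bv)\big).$$ Let $[\cdot,\cdot]_G$ be the Gerstenhaber bracket on $\bigoplus_{n\ge 0}\mathrm{Hom}(\otimes^{n+1}\mathcal A,\mathcal A)$ (elements of $\mathrm{Hom}(\otimes^{n+1}\mathcal A,\mathcal A)$ have degree $n$). Regard the components of $\Omega$, and the elements of $F=\bigoplus_{n\ge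 0}\mathrm{Hom}(\otimes^{n+1}A',A)$, as cochains on $\mathcal A$ by extending them by zero. Let $F$ carry the operations $$l_1(f)=[\xi+\eta+\beta,f]_G,\qquad l_2(f_1,f_2)=[[\pi+\rho+\mu,f_1]_G,f_2]_G,\qquad l_3(f_1,f_2,f_3)=[[[\theta,f_1]_G,f_2]_G,f_3]_G,$$ and $l_k=0$ for all other $k$. Let $B:A'\to A$ be a left deformation map, regarded as a degree $0$ element of $F$, and let $l_k^B(f_1,\dots,f_k)=\sum_{n\ge0}\frac1{n!}\,l_{k+n}(B,\dots,B,f_1,\dots,f_k)$, $k\ge 1$, be the operations twisted by $B$, that is, $$l_1^B(f)=l_1(f)+l_2(B,f)+\tfrac12 l_3(B,B,f),\quad l_2^B(f_1,f_2)=l_2(f_1,f_2)+l_3(B,f_1,f_2),\quad l_3^B=l_3,\quad l_k^B=0\ (k\ge4).$$ Let $B':A'\to A$ be a linear map. Then $B+B'$ is a left deformation map of $(\mathcal A,A,A')$ if and only if $B'$ is a Maurer–Cartan element of the twisted $L_\infty$-algebra $(F,l_1^B,l_2^B,l_3^B)$, i.e. the degree $0$ element $B'$ satisfies $$\sum_{k\ge1}\frac1{k!}\,l_k^B(B',\dots,B')=0.$$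 -/

import Mathlib

open scoped DirectSum

noncomputable section

/-! ## Consecutive entries of a list -/

section Lists

variable {V : Type*}

/-- The `n + 1` consecutive entries `x_i, …, x_{i+n}` of a list of length `m + n + 1`. -/
def window {m : ℕ} (n : ℕ) (i : Fin (m + 1)) (x : Fin (m + n + 1) → V) : Fin (n + 1) → V :=
  fun k => x ⟨i + k, by omega⟩

/-- The list `x_0, …, x_{i-1}, w, x_{i+n+1}, …, x_{m+n}` of length `m + 1`. -/
def contract {m : ℕ} (n : ℕ) (i : Fin (m + 1)) (w : V) (x : Fin (m + n + 1) → V) :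
    Fin (m + 1) → V :=
  fun j => if j < i then x ⟨j, by omega⟩ else if j = i then w else x ⟨j + n, by omega⟩

theorem window_update_of_notMem {m n : ℕ} (i : Fin (m + 1)) (x : Fin (m + n + 1) → V)
    (t : Fin (m + n + 1)) (a : V) (h : (t : ℕ) < i ∨ (i : ℕ) + n < t) :
    window n i (Function.update x t a) = window n i x := by
  funext k
  have : (⟨i + k, by omega⟩ : Fin (m + n + 1)) ≠ t := by
    rw [Ne, Fin.ext_iff]; simp only; omega
  simp [window, Function.update_of_ne this]

theorem window_update_of_mem {m n : ℕ} (i : Fin (m + 1)) (x : Fin (m + n + 1) → V)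
    (t : Fin (m + n + 1)) (a : V) (h : (i : ℕ) ≤ t) (h' : (t : ℕ) ≤ i + n) :
    window n i (Function.update x t a) =
      Function.update (window n i x) ⟨t - i, by omega⟩ a := by
  funext k
  simp only [window, Function.update_apply, Fin.ext_iff]
  grind

theorem contract_update_of_lt {m n : ℕ} (i : Fin (m + 1)) (w : V) (x : Fin (m + n + 1) → V)
    (t : Fin (m + n + 1)) (a : V) (h : (t : ℕ) < i) :
    contract n i w (Function.update x t a) =
      Function.update (contract n i w x) ⟨t, by omega⟩ a := by
  funext j
  simp only [contract, Function.update_apply, Fin.ext_iff, Fin.lt_def]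
  grind

theorem contract_update_of_gt {m n : ℕ} (i : Fin (m + 1)) (w : V) (x : Fin (m + n + 1) → V)
    (t : Fin (m + n + 1)) (a : V) (h : (i : ℕ) + n < t) :
    contract n i w (Function.update x t a) =
      Function.update (contract n i w x) ⟨t - n, by omega⟩ a := by
  funext j
  simp only [contract, Function.update_apply, Fin.ext_iff, Fin.lt_def]
  grind

theorem contract_update_of_mem {m n : ℕ} (i : Fin (m + 1)) (w : V) (x : Fin (m + n + 1) → V)
    (t : Fin (m + n + 1)) (a w₀ : V) (h : (i : ℕ) ≤ t) (h' : (t : ℕ) ≤ i + n) :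
    contract n i w (Function.update x t a) = Function.update (contract n i w₀ x) i w := by
  funext j
  simp only [contract, Function.update_apply, Fin.ext_iff, Fin.lt_def]
  grind

theorem contract_eq_update {m n : ℕ} (i : Fin (m + 1)) (w w₀ : V) (x : Fin (m + n + 1) → V) :
    contract n i w x = Function.update (contract n i w₀ x) i w := by
  funext j
  simp only [contract, Function.update_apply, Fin.ext_iff, Fin.lt_def]
  grind

end Lists

/-! ## Cochains and the Gerstenhaber bracket -/

section Cochains

variable (K : Type*) [Field K]

/-- Cochains of degree `n`: linear maps `⊗^{n+1} V → W`, encoded as multilinear maps. -/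
abbrev Cochain (V W : Type*) [AddCommGroup V] [Module K V] [AddCommGroup W] [Module K W] (n : ℕ) :
    Type _ :=
  MultilinearMap K (fun _ : Fin (n + 1) => V) W

/-- The graded vector space `⊕_{n ≥ 0} Hom(⊗^{n+1} V, W)`; the `n`-th summand has degree `n`. -/
abbrev Cochains (V W : Type*) [AddCommGroup V] [Module K V] [AddCommGroup W] [Module K W] :
    Type _ :=
  ⨁ n : ℕ, Cochain K V W n

variable {K}
variable {V W V' W' : Type*} [AddCommGroup V] [Module K V] [AddCommGroup W] [Module K W]
  [AddCommGroup V'] [Module K V'] [AddCommGroup W'] [Module K W']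

/-- A linear map, seen as an element of degree `0` of `⊕_{n ≥ 0} Hom(⊗^{n+1} V, W)`. -/
def ofLinear (f : V →ₗ[K] W) : Cochains K V W :=
  DirectSum.lof K ℕ (fun n => Cochain K V W n) 0 (MultilinearMap.ofSubsingleton K V W (0 : Fin 1) f)

/-- A bilinear map, seen as a cochain of degree `1`. -/
def bilinCochain (f : V →ₗ[K] V →ₗ[K] W) : Cochain K V W 1 where
  toFun x := f (x 0) (x 1)
  map_update_add' {inst} x t a b := by
    cases Subsingleton.elim inst (instDecidableEqFin _)
    fin_cases t <;> simp
  map_update_smul' {inst} x t c a := by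
    cases Subsingleton.elim inst (instDecidableEqFin _)
    fin_cases t <;> simp

/-- A bilinear map, seen as an element of degree `1` of `⊕_{n ≥ 0} Hom(⊗^{n+1} V, W)`. -/
def ofBilin (f : V →ₗ[K] V →ₗ[K] W) : Cochains K V W :=
  DirectSum.lof K ℕ (fun n => Cochain K V W n) 1 (bilinCochain f)

/-- The linear map `c ↦ q ∘ c ∘ (p ⊗ ⋯ ⊗ p)` on the graded vector space of cochains. -/
def conjCochains (p : V' →ₗ[K] V) (q : W →ₗ[K] W') : Cochains K V W →ₗ[K] Cochains K V' W' :=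
  DirectSum.lmap fun n =>
    { toFun := fun c : Cochain K V W n => q.compMultilinearMap (c.compLinearMap fun _ => p)
      map_add' := fun _ _ => by ext; simp
      map_smul' := fun _ _ => by ext; simp }

/-- Insertion of `g` in the `i`-th slot of `f`:
`(x_0, …, x_{m+n}) ↦ f (x_0, …, x_{i-1}, g (x_i, …, x_{i+n}), x_{i+n+1}, …, x_{m+n})`. -/
def insertAt {m n : ℕ} (f : Cochain K V V m) (g : Cochain K V V n) (i : Fin (m + 1)) :
    Cochain K V V (m + n) where
  toFun x := f (contract n i (g (window n i x)) x)
  map_update_add' {inst} x t a b := by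
    cases Subsingleton.elim inst (instDecidableEqFin _)
    rcases lt_or_ge (t : ℕ) i with h | h
    · simp only [window_update_of_notMem i x t _ (Or.inl h), contract_update_of_lt i _ x t _ h,
        MultilinearMap.map_update_add]
    rcases lt_or_ge ((i : ℕ) + n) t with h' | h'
    · simp only [window_update_of_notMem i x t _ (Or.inr h'), contract_update_of_gt i _ x t _ h',
        MultilinearMap.map_update_add]
    · simp only [window_update_of_mem i x t _ h h', contract_update_of_mem i _ x t _ 0 h h',
        MultilinearMap.map_update_add]
  map_update_smul' {inst} x t c a := by
    cases Subsingleton.elim inst (instDecidableEqFin _)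
    rcases lt_or_ge (t : ℕ) i with h | h
    · simp only [window_update_of_notMem i x t _ (Or.inl h), contract_update_of_lt i _ x t _ h,
        MultilinearMap.map_update_smul]
    rcases lt_or_ge ((i : ℕ) + n) t with h' | h'
    · simp only [window_update_of_notMem i x t _ (Or.inr h'), contract_update_of_gt i _ x t _ h',
        MultilinearMap.map_update_smul]
    · simp only [window_update_of_mem i x t _ h h', contract_update_of_mem i _ x t _ 0 h h',
        MultilinearMap.map_update_smul]

theorem map_contract_add {m n : ℕ} (f : Cochain K V V m) (i : Fin (m + 1)) (w w' : V)
    (x : Fin (m + n + 1) → V) :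
    f (contract n i (w + w') x) = f (contract n i w x) + f (contract n i w' x) := by
  rw [contract_eq_update i (w + w') 0, contract_eq_update i w 0, contract_eq_update i w' 0,
    MultilinearMap.map_update_add]

theorem map_contract_smul {m n : ℕ} (f : Cochain K V V m) (i : Fin (m + 1)) (c : K) (w : V)
    (x : Fin (m + n + 1) → V) :
    f (contract n i (c • w) x) = c • f (contract n i w x) := by
  rw [contract_eq_update i (c • w) 0, contract_eq_update i w 0, MultilinearMap.map_update_smul]

/-- The composition `f ∘ g = ∑_i (-1)^{i n} f (…, g (x_i, …, x_{i+n}), …)` of cochains of degrees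
`m` and `n` (`i` counts from `0`), bilinear in `f` and `g`. -/
def circ (m n : ℕ) : Cochain K V V m →ₗ[K] Cochain K V V n →ₗ[K] Cochain K V V (m + n) :=
  LinearMap.mk₂ K (fun f g => ∑ i : Fin (m + 1), (-1 : K) ^ ((i : ℕ) * n) • insertAt f g i)
    (fun f f' g => by
      ext x
      simp [insertAt, Finset.sum_add_distrib])
    (fun c f g => by
      ext x
      simp [insertAt, Finset.smul_sum, smul_comm c])
    (fun f g g' => by
      ext x
      simp [insertAt, map_contract_add, Finset.sum_add_distrib])
    (fun c f g => by
      ext x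
      simp [insertAt, map_contract_smul, Finset.smul_sum, smul_comm c])

/-- The composition `∘`, extended bilinearly to `⊕_{n ≥ 0} Hom(⊗^{n+1} V, V)`. -/
def circL : Cochains K V V →ₗ[K] Cochains K V V →ₗ[K] Cochains K V V :=
  DirectSum.toModule K ℕ _ fun m =>
    LinearMap.flip (DirectSum.toModule K ℕ (Cochain K V V m →ₗ[K] Cochains K V V) fun n =>
      ((circ m n).compr₂ (DirectSum.lof K ℕ (fun k => Cochain K V V k) (m + n))).flip)

/-- The opposite composition with its sign: `(f, g) ↦ (-1)^{mn} g ∘ f` for `f`, `g` of degrees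
`m`, `n`, extended bilinearly. -/
def circOpL : Cochains K V V →ₗ[K] Cochains K V V →ₗ[K] Cochains K V V :=
  DirectSum.toModule K ℕ _ fun m =>
    LinearMap.flip (DirectSum.toModule K ℕ (Cochain K V V m →ₗ[K] Cochains K V V) fun n =>
      (-1 : K) ^ (m * n) •
        (circ n m).compr₂ (DirectSum.lof K ℕ (fun k => Cochain K V V k) (n + m)))

/-- The Gerstenhaber bracket `[f, g] = f ∘ g - (-1)^{mn} g ∘ f` (`f`, `g` of degrees `m`, `n`). -/
def gerstenhaber : Cochains K V V →ₗ[K] Cochains K V V →ₗ[K] Cochains K V V :=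
  circL + (-1 : K) • circOpL

end Cochains

/-! ## Families of operations, Maurer–Cartan elements, twisting -/

section LInfinity

variable (K : Type*) [Field K]

/-- A family of multilinear operations `l_k : ⊗^k F → F`, `k ≥ 0`. -/
abbrev Operations (F : Type*) [AddCommGroup F] [Module K F] : Type _ :=
  ∀ k : ℕ, MultilinearMap K (fun _ : Fin k => F) F

variable {K}

/-- `x` is a Maurer–Cartan element for the operations `l_k` on the graded space `⊕ M n`: it has
degree `0` and `l_0 + ∑_{k ≥ 1} (1 / k!) l_k (x, …, x) = 0`. The sum is finite for every family of
operations that vanish from some arity on. -/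
def IsMaurerCartan {M : ℕ → Type*} [∀ n, AddCommGroup (M n)] [∀ n, Module K (M n)]
    (l : Operations K (⨁ n, M n)) (x : ⨁ n, M n) : Prop :=
  x ∈ LinearMap.range (DirectSum.lof K ℕ M 0) ∧
    ∑ᶠ k : ℕ, ((k.factorial : K)⁻¹) • l k (fun _ => x) = 0

variable {F : Type*} [AddCommGroup F] [Module K F]

/-- Filling the first `n` entries of an operation with `x`:
`(x_1, …, x_k) ↦ f (x, …, x, x_1, …, x_k)`. -/
def fillFirst (x : F) (k : ℕ) :
    ∀ n : ℕ, MultilinearMap K (fun _ : Fin (k + n) => F) F → MultilinearMap K (fun _ : Fin k => F) F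
  | 0, f => f
  | n + 1, f => fillFirst x k n (MultilinearMap.curryLeft (n := k + n) f x)

/-- The operations twisted by `x`:
`l_k^x (x_1, …, x_k) = ∑_{n ≥ 0} (1 / n!) l_{k+n} (x, …, x, x_1, …, x_k)` for `k ≥ 1`, and
`l_0^x = 0`. The sum is finite for operations that vanish from some arity on. -/
def twist (l : Operations K F) (x : F) : Operations K F
  | 0 => 0
  | k + 1 => ∑ᶠ n : ℕ, ((n.factorial : K)⁻¹) • fillFirst x (k + 1) n (l (k + 1 + n))

end LInfinity

/-! ## Quasi-twilled associative algebras -/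

/-- A quasi-twilled associative algebra structure on an associative (not necessarily unital)
algebra `𝒜`: a decomposition `𝒜 = A ⊕ A'` into subspaces such that `A'` is a subalgebra. -/
structure QuasiTwilled (K 𝒜 : Type*) [Field K] [NonUnitalRing 𝒜] [Module K 𝒜] where
  /-- the subspace `A` -/
  A : Submodule K 𝒜
  /-- the subspace `A'` -/
  A' : Submodule K 𝒜
  isCompl : IsCompl A A'
  mul_mem : ∀ ⦃u v : 𝒜⦄, u ∈ A' → v ∈ A' → u * v ∈ A'

namespace QuasiTwilled

variable {K 𝒜 : Type*} [Field K] [NonUnitalRing 𝒜] [Module K 𝒜]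
variable (T : QuasiTwilled K 𝒜)

/-- The projection `𝒜 → A` along `A'`. -/
def pr : 𝒜 →ₗ[K] T.A := T.A.projectionOnto T.A' T.isCompl

/-- The projection `𝒜 → A'` along `A`. -/
def pr' : 𝒜 →ₗ[K] T.A' := T.A'.projectionOnto T.A T.isCompl.symm

/-- The lift `⊕ Hom(⊗^{n+1} A', A) → ⊕ Hom(⊗^{n+1} 𝒜, 𝒜)` (zero on all the other summands of
`⊗^{n+1} 𝒜`). -/
def lift : Cochains K T.A' T.A →ₗ[K] Cochains K 𝒜 𝒜 := conjCochains T.pr' T.A.subtype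

/-- The projection `P : ⊕ Hom(⊗^{n+1} 𝒜, 𝒜) → ⊕ Hom(⊗^{n+1} A', A)`, a left inverse of the
lift. -/
def proj : Cochains K 𝒜 𝒜 →ₗ[K] Cochains K T.A' T.A := conjCochains T.A'.subtype T.pr

/-- The iterated bracket `(f_1, …, f_k) ↦ [⋯[[Δ, f_1], f_2], ⋯, f_k]` with the lifts of
`f_i ∈ ⊕ Hom(⊗^{n+1} A', A)`, linear in `Δ` and multilinear in the `f_i`. -/
def iteratedBracket : ∀ k : ℕ, Cochains K 𝒜 𝒜 →ₗ[K]
    MultilinearMap K (fun _ : Fin k => Cochains K T.A' T.A) (Cochains K 𝒜 𝒜)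
  | 0 => (MultilinearMap.constLinearEquivOfIsEmpty K K _ _).toLinearMap
  | k + 1 => (multilinearCurryLeftEquiv K (fun _ : Fin (k + 1) => Cochains K T.A' T.A)
      (Cochains K 𝒜 𝒜)).symm.toLinearMap ∘ₗ
        (gerstenhaber.compl₂ T.lift).compr₂ (iteratedBracket k)

variable [IsScalarTower K 𝒜 𝒜] [SMulCommClass K 𝒜 𝒜]

/-! The components of the multiplication: for `x, y ∈ A` and `u, v ∈ A'`,
`(x + u) (y + v) = (π x y + ξ x v + η u y) + (β u v + ρ x v + μ u y + θ x y)`. -/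

/-- The component `A ⊗ A → A`. -/
def π : T.A →ₗ[K] T.A →ₗ[K] T.A :=
  ((LinearMap.mul K 𝒜).compl₁₂ T.A.subtype T.A.subtype).compr₂ T.pr

/-- The component `A ⊗ A' → A`. -/
def ξ : T.A →ₗ[K] T.A' →ₗ[K] T.A :=
  ((LinearMap.mul K 𝒜).compl₁₂ T.A.subtype T.A'.subtype).compr₂ T.pr

/-- The component `A' ⊗ A → A`. -/
def η : T.A' →ₗ[K] T.A →ₗ[K] T.A :=
  ((LinearMap.mul K 𝒜).compl₁₂ T.A'.subtype T.A.subtype).compr₂ T.pr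

/-- The component `A' ⊗ A' → A'`. -/
def β : T.A' →ₗ[K] T.A' →ₗ[K] T.A' :=
  ((LinearMap.mul K 𝒜).compl₁₂ T.A'.subtype T.A'.subtype).compr₂ T.pr'

/-- The component `A ⊗ A' → A'`. -/
def ρ : T.A →ₗ[K] T.A' →ₗ[K] T.A' :=
  ((LinearMap.mul K 𝒜).compl₁₂ T.A.subtype T.A'.subtype).compr₂ T.pr'

/-- The component `A' ⊗ A → A'`. -/
def μ : T.A' →ₗ[K] T.A →ₗ[K] T.A' :=
  ((LinearMap.mul K 𝒜).compl₁₂ T.A'.subtype T.A.subtype).compr₂ T.pr'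

/-- The component `A ⊗ A → A'`. -/
def θ : T.A →ₗ[K] T.A →ₗ[K] T.A' :=
  ((LinearMap.mul K 𝒜).compl₁₂ T.A.subtype T.A.subtype).compr₂ T.pr'

/-- Left deformation maps `B : A' → A`. -/
def IsLeftDeformationMap (B : T.A' →ₗ[K] T.A) : Prop :=
  ∀ u v : T.A',
    T.π (B u) (B v) + T.ξ (B u) v + T.η u (B v) =
      B (T.β u v + T.ρ (B u) v + T.μ u (B v) + T.θ (B u) (B v))

/-! The lifts of the components to cochains on `𝒜` (zero on all the other summands of
`𝒜 ⊗ 𝒜`), as elements of degree `1` of `⊕_{n ≥ 0} Hom(⊗^{n+1} 𝒜, 𝒜)`. -/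

/-- The lift of `π`. -/
def πL : Cochains K 𝒜 𝒜 := ofBilin ((T.π.compl₁₂ T.pr T.pr).compr₂ T.A.subtype)

/-- The lift of `ξ`. -/
def ξL : Cochains K 𝒜 𝒜 := ofBilin ((T.ξ.compl₁₂ T.pr T.pr').compr₂ T.A.subtype)

/-- The lift of `η`. -/
def ηL : Cochains K 𝒜 𝒜 := ofBilin ((T.η.compl₁₂ T.pr' T.pr).compr₂ T.A.subtype)

/-- The lift of `β`. -/
def βL : Cochains K 𝒜 𝒜 := ofBilin ((T.β.compl₁₂ T.pr' T.pr').compr₂ T.A'.subtype)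

/-- The lift of `ρ`. -/
def ρL : Cochains K 𝒜 𝒜 := ofBilin ((T.ρ.compl₁₂ T.pr T.pr').compr₂ T.A'.subtype)

/-- The lift of `μ`. -/
def μL : Cochains K 𝒜 𝒜 := ofBilin ((T.μ.compl₁₂ T.pr' T.pr).compr₂ T.A'.subtype)

/-- The lift of `θ`. -/
def θL : Cochains K 𝒜 𝒜 := ofBilin ((T.θ.compl₁₂ T.pr T.pr).compr₂ T.A'.subtype)

/-- The operations on `⊕_{n ≥ 0} Hom(⊗^{n+1} A', A)`:
`l_1 f = [ξ + η + β, f]`, `l_2 (f_1, f_2) = [[π + ρ + μ, f_1], f_2]`,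
`l_3 (f_1, f_2, f_3) = [[[θ, f_1], f_2], f_3]`, and `l_k = 0` otherwise. The brackets are taken in
`⊕ Hom(⊗^{n+1} 𝒜, 𝒜)`; they lie in the image of the lift, and `proj` reads them as elements of
`⊕ Hom(⊗^{n+1} A', A)`. -/
def l : Operations K (Cochains K T.A' T.A)
  | 1 => T.proj.compMultilinearMap (T.iteratedBracket 1 (T.ξL + T.ηL + T.βL))
  | 2 => T.proj.compMultilinearMap (T.iteratedBracket 2 (T.πL + T.ρL + T.μL))
  | 3 => T.proj.compMultilinearMap (T.iteratedBracket 3 T.θL)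
  | _ => 0

end QuasiTwilled

end

/-!
For operations `l_k` that are symmetric on elements of degree `0`, the binomial theorem gives
`m (x) = ∑ (1 / k!) l_k (x, …, x)` the Taylor expansion `m (x + y) = m (x) + m^x (y)`, where `m^x`
is formed with the operations twisted by `x`. For a linear map `B : A' → A` one finds
`l_k (B, …, B) = k! D_k (B)`, where `D_k (B)` is the part of degree `k` in `B` of the equation that
defines left deformation maps; hence these are the zeros of `m`, and if `m (B) = 0`, then
`m (B + B') = m^B (B')`.

The operations are symmetric in degree `0` because bracketing with a linear map is an action of the
Lie algebra `End 𝒜` on bilinear maps, and linear maps `A' → A`, extended by zero to `𝒜`, have zero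
composites and so commute.
-/

open Finset.HasAntidiagonal (antidiagonal)

noncomputable section

section SymmetricMultilinear

variable {R ι F G : Type*} [CommSemiring R] [AddCommMonoid F] [Module R F] [AddCommMonoid G]
  [Module R G]

/-- The multilinear map `f` is symmetric as long as all its entries lie in `S`. For operations on a
graded space this is the part of graded symmetry that concerns the elements of one even degree. -/
def IsSymmetricOn (f : MultilinearMap R (fun _ : ι => F) G) (S : Set F) : Prop :=
  ∀ (σ : Equiv.Perm ι) (v : ι → F), (∀ i, v i ∈ S) → f (v ∘ σ) = f v

theorem IsSymmetricOn.apply_piecewise_eq [Finite ι] [DecidableEq ι]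
    {f : MultilinearMap R (fun _ : ι => F) G} {S : Set F} (hf : IsSymmetricOn f S) {x y : F}
    (hx : x ∈ S) (hy : y ∈ S) {s t : Finset ι} (hst : s.card = t.card) :
    f (s.piecewise (fun _ => x) fun _ => y) = f (t.piecewise (fun _ => x) fun _ => y) := by
  let σ : Equiv.Perm ι := (Finset.equivOfCardEq hst).extendSubtype
  have hσ (i : ι) : σ i ∈ t ↔ i ∈ s :=
    ⟨fun h => by_contra fun hi => Equiv.extendSubtype_not_mem _ i hi h,
      Equiv.extendSubtype_mem _ i⟩
  have mem_S (i : ι) : t.piecewise (fun _ => x) (fun _ => y) i ∈ S :=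
    t.piecewise_cases (i := i) (fun _ => x) (fun _ => y) (· ∈ S) hx hy
  rw [← hf σ _ mem_S]
  congr 1
  ext i
  simp only [Function.comp_apply, Finset.piecewise, hσ]

theorem IsSymmetricOn.apply_const_add {m : ℕ} {f : MultilinearMap R (fun _ : Fin m => F) G}
    {S : Set F} (hf : IsSymmetricOn f S) {x y : F} (hx : x ∈ S) (hy : y ∈ S) :
    f (fun _ => x + y) = ∑ n ∈ Finset.range (m + 1),
      m.choose n • f fun i => if (i : ℕ) < n then x else y := by
  have apply_piecewise (s : Finset (Fin m)) : f (s.piecewise (fun _ => x) fun _ => y) =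
      f fun i => if (i : ℕ) < s.card then x else y := by
    have hs : s.card ≤ m := by simpa using s.card_le_univ
    rw [hf.apply_piecewise_eq hx hy (t := {i | (i : ℕ) < s.card})
      (by simp [Fin.card_filter_val_lt, hs])]
    congr 1
    ext i
    simp [Finset.piecewise]
  calc f (fun _ => x + y) = ∑ s : Finset (Fin m), f (s.piecewise (fun _ => x) fun _ => y) :=
        f.map_add_univ _ _
    _ = ∑ s ∈ (Finset.univ : Finset (Fin m)).powerset,
          f fun i => if (i : ℕ) < s.card then x else y := by
        simp only [apply_piecewise, Finset.powerset_univ]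
    _ = _ := by
        rw [Finset.sum_powerset_apply_card fun n => f fun i => if (i : ℕ) < n then x else y,
          Finset.card_univ, Fintype.card_fin]

end SymmetricMultilinear

theorem sum_range_sum_antidiagonal_eq {G : Type*} [AddCommMonoid G] {N : ℕ} {a : ℕ → ℕ → G}
    (ha : ∀ i j, N < i + j → a i j = 0) :
    ∑ k ∈ Finset.range (N + 1), ∑ p ∈ antidiagonal k, a p.1 p.2 =
      ∑ i ∈ Finset.range (N + 1), ∑ j ∈ Finset.range (N + 1), a i j := by
  rw [← Finset.sum_product', Finset.sum_sigma']
  refine Finset.sum_of_injOn (fun p => p.2) ?_ ?_ ?_ fun _ _ => rfl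
  · rintro ⟨k, p⟩ h ⟨k', p'⟩ h' rfl
    simp_all
  · rintro ⟨k, p⟩ h
    simp only [Finset.coe_sigma, Set.mem_sigma_iff, Finset.coe_range, Set.mem_Iio, SetLike.mem_coe,
      Finset.HasAntidiagonal.mem_antidiagonal] at h
    simp only [Finset.coe_product, Finset.coe_range, Set.mem_prod, Set.mem_Iio]
    omega
  · rintro ⟨i, j⟩ - h
    refine ha i j (not_le.1 fun hij => h ⟨⟨i + j, i, j⟩, ?_, rfl⟩)
    simpa [Nat.lt_succ_iff] using hij

section Factorial

variable {K : Type*} [Field K]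

theorem cast_factorial_ne_zero_of_le {m n : ℕ} (hmn : m ≤ n) (hn : (n.factorial : K) ≠ 0) :
    (m.factorial : K) ≠ 0 :=
  ne_zero_of_dvd_ne_zero hn (Nat.cast_dvd_cast (Nat.factorial_dvd_factorial hmn))

theorem inv_factorial_mul_choose {k n : ℕ} (hkn : ((k + n).factorial : K) ≠ 0) :
    ((k + n).factorial : K)⁻¹ * (k + n).choose n = (k.factorial : K)⁻¹ * (n.factorial : K)⁻¹ := by
  have hk : (k.factorial : K) ≠ 0 := cast_factorial_ne_zero_of_le (by omega) hkn
  have hn : (n.factorial : K) ≠ 0 := cast_factorial_ne_zero_of_le (by omega) hkn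
  have hchoose : ((k + n).choose n : K) * k.factorial * n.factorial = (k + n).factorial := by
    rw [← Nat.cast_mul, ← Nat.cast_mul, Nat.add_choose_mul_factorial_mul_factorial]
  field_simp
  linear_combination hchoose

end Factorial

section Twisting

variable {K F : Type*} [Field K] [AddCommGroup F] [Module K F]

theorem fillFirst_zero (x : F) (k n : ℕ) :
    fillFirst x k n (0 : MultilinearMap K (fun _ : Fin (k + n) => F) F) = 0 := by
  induction n with
  | zero => rfl
  | succ _ ih => exact ih

theorem fillFirst_apply_const (x y : F) (k n : ℕ)
    (f : MultilinearMap K (fun _ : Fin (k + n) => F) F) :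
    fillFirst x k n f (fun _ => y) = f fun i => if (i : ℕ) < n then x else y := by
  induction n with
  | zero => simp [fillFirst]
  | succ n ih =>
    rw [fillFirst, ih, MultilinearMap.curryLeft_apply]
    congr 1
    ext i
    cases i using Fin.cases <;> simp

/-- The curvature `∑_k (1 / k!) l_k (x, …, x)` of `x`: the left-hand side of the Maurer–Cartan
equation. It is meant for operations that vanish from some arity on, so that the sum is finite. -/
def Operations.curvature (l : Operations K F) (x : F) : F :=
  ∑ᶠ k : ℕ, ((k.factorial : K)⁻¹) • l k (fun _ => x)

namespace Operations

variable {l : Operations K F} {N : ℕ}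

theorem curvature_eq_sum (hl : ∀ k, N < k → l k = 0) (x : F) :
    l.curvature x =
      ∑ k ∈ Finset.range (N + 1), ((k.factorial : K)⁻¹) • l k (fun _ => x) := by
  refine finsum_eq_sum_of_support_subset _ fun k hk => ?_
  by_contra hkN
  exact hk (by simp [hl k (by simpa using hkN)])

theorem twist_succ_eq_sum (hl : ∀ k, N < k → l k = 0) (x : F) (k : ℕ) :
    twist l x (k + 1) = ∑ n ∈ Finset.range (N + 1),
      ((n.factorial : K)⁻¹) • fillFirst x (k + 1) n (l (k + 1 + n)) := by
  refine finsum_eq_sum_of_support_subset _ fun n hn => ?_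
  by_contra hnN
  have hkn : N < k + 1 + n := by
    rw [Finset.mem_coe, Finset.mem_range] at hnN
    omega
  exact hn (by simp [hl _ hkn, fillFirst_zero])

theorem twist_eq_zero (hl : ∀ k, N < k → l k = 0) (x : F) {k : ℕ} (hk : N < k) :
    twist l x k = 0 := by
  obtain ⟨k, rfl⟩ := Nat.exists_eq_add_one_of_ne_zero (Nat.ne_zero_of_lt hk)
  rw [twist_succ_eq_sum hl]
  exact Finset.sum_eq_zero fun n _ => by rw [hl _ (by omega), fillFirst_zero, smul_zero]

theorem curvature_twist (hl : ∀ k, N < k → l k = 0) (x y : F) :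
    (twist l x).curvature y = ∑ k ∈ Finset.range N, ∑ n ∈ Finset.range (N + 1),
      (((k + 1).factorial : K)⁻¹ * (n.factorial : K)⁻¹) •
        fillFirst x (k + 1) n (l (k + 1 + n)) fun _ => y := by
  have twist_zero : twist l x 0 = 0 := rfl
  simp [curvature_eq_sum fun _ => twist_eq_zero hl x, Finset.sum_range_succ' _ N, twist_zero,
    twist_succ_eq_sum hl, Finset.smul_sum, mul_smul]

theorem inv_factorial_smul_apply_const_add {S : Set F} {m : ℕ} (hl : IsSymmetricOn (l m) S)
    (hm : (m.factorial : K) ≠ 0) {x y : F} (hx : x ∈ S) (hy : y ∈ S) :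
    (m.factorial : K)⁻¹ • l m (fun _ => x + y) = ∑ p ∈ antidiagonal m,
      ((p.1.factorial : K)⁻¹ * (p.2.factorial : K)⁻¹) •
        fillFirst x p.1 p.2 (l (p.1 + p.2)) fun _ => y := by
  rw [hl.apply_const_add hx hy, Finset.smul_sum, ← Finset.Nat.sum_antidiagonal_eq_sum_range_succ_mk
    fun p => (m.factorial : K)⁻¹ • m.choose p.1 • l m fun i => if (i : ℕ) < p.1 then x else y,
    ← Finset.Nat.sum_antidiagonal_swap]
  refine Finset.sum_congr rfl fun ⟨k, n⟩ hkn => ?_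
  obtain rfl := Finset.HasAntidiagonal.mem_antidiagonal.1 hkn
  rw [Prod.fst_swap, fillFirst_apply_const, ← Nat.cast_smul_eq_nsmul K, smul_smul,
    inv_factorial_mul_choose hm]

/-- Taylor expansion at `x`: twisting by `x` removes the constant term `l.curvature x`, because
`twist` has no operation of arity `0`. -/
theorem curvature_add {S : Set F} (hsymm : ∀ k, IsSymmetricOn (l k) S)
    (hl : ∀ k, N < k → l k = 0) (hN : (N.factorial : K) ≠ 0) {x y : F} (hx : x ∈ S)
    (hy : y ∈ S) :
    l.curvature (x + y) = l.curvature x + (twist l x).curvature y := by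
  let a (k n : ℕ) : F := ((k.factorial : K)⁻¹ * (n.factorial : K)⁻¹) •
    fillFirst x k n (l (k + n)) fun _ => y
  have ha (k n : ℕ) (h : N < k + n) : a k n = 0 := by
    simp only [a, hl _ h, fillFirst_zero, zero_apply, smul_zero]
  have ha_zero (n : ℕ) : a 0 n = (n.factorial : K)⁻¹ • l n fun _ => x := by
    have l_zero_add : (l (0 + n) fun _ => x) = l n fun _ => x :=
      congrArg (fun m => l m fun _ => x) (zero_add n)
    have lt_card (i : Fin (0 + n)) : (i : ℕ) < n := by omega
    simp only [a, fillFirst_apply_const, lt_card, if_true, l_zero_add, Nat.factorial_zero,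
      Nat.cast_one, inv_one, one_mul]
  calc l.curvature (x + y)
      = ∑ m ∈ Finset.range (N + 1), ∑ p ∈ antidiagonal m, a p.1 p.2 := by
        rw [curvature_eq_sum hl]
        refine Finset.sum_congr rfl fun m hm => ?_
        have hmN : m ≤ N := Finset.mem_range_succ_iff.1 hm
        exact inv_factorial_smul_apply_const_add (hsymm m) (cast_factorial_ne_zero_of_le hmN hN)
          hx hy
    _ = ∑ k ∈ Finset.range (N + 1), ∑ n ∈ Finset.range (N + 1), a k n :=
        sum_range_sum_antidiagonal_eq ha
    _ = l.curvature x + (twist l x).curvature y := by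
        rw [Finset.sum_range_succ', add_comm, curvature_twist hl, curvature_eq_sum hl]
        simp only [ha_zero, a]

end Operations

end Twisting

section Cochains

variable {K : Type*} [Field K] {V W V' W' : Type*} [AddCommGroup V] [Module K V] [AddCommGroup W]
  [Module K W] [AddCommGroup V'] [Module K V'] [AddCommGroup W'] [Module K W']

theorem ofLinear_add (f g : V →ₗ[K] W) : ofLinear (f + g) = ofLinear f + ofLinear g := by
  rw [ofLinear, ofLinear, ofLinear, ← map_add]
  rfl

theorem ofBilin_add (D E : V →ₗ[K] V →ₗ[K] W) : ofBilin (D + E) = ofBilin D + ofBilin E := by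
  rw [ofBilin, ofBilin, ofBilin, ← map_add]
  rfl

theorem ofBilin_smul (c : K) (D : V →ₗ[K] V →ₗ[K] W) : ofBilin (c • D) = c • ofBilin D := by
  rw [ofBilin, ofBilin, ← map_smul]
  rfl

theorem ofBilin_sub (D E : V →ₗ[K] V →ₗ[K] W) : ofBilin (D - E) = ofBilin D - ofBilin E := by
  rw [ofBilin, ofBilin, ofBilin, ← map_sub]
  rfl

theorem ofBilin_zero : ofBilin (0 : V →ₗ[K] V →ₗ[K] W) = 0 :=
  map_zero (DirectSum.lof K ℕ (fun n => Cochain K V W n) 1)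

theorem ofBilin_sum {ι : Type*} (s : Finset ι) (D : ι → V →ₗ[K] V →ₗ[K] W) :
    ofBilin (∑ i ∈ s, D i) = ∑ i ∈ s, ofBilin (D i) :=
  map_sum (AddMonoidHom.mk' ofBilin ofBilin_add) D s

theorem ofBilin_injective :
    Function.Injective (ofBilin : (V →ₗ[K] V →ₗ[K] W) → Cochains K V W) := by
  intro D E h
  have h' : bilinCochain D = bilinCochain E := DirectSum.of_injective 1 h
  ext x y
  exact DFunLike.congr_fun h' ![x, y]

theorem ofBilin_eq_zero_iff (D : V →ₗ[K] V →ₗ[K] W) : ofBilin D = 0 ↔ D = 0 := by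
  rw [← ofBilin_zero, ofBilin_injective.eq_iff]

theorem conjCochains_ofLinear (p : V' →ₗ[K] V) (q : W →ₗ[K] W') (f : V →ₗ[K] W) :
    conjCochains p q (ofLinear f) = ofLinear (q ∘ₗ f ∘ₗ p) := by
  rw [conjCochains, ofLinear, ofLinear, DirectSum.lmap_lof]
  rfl

theorem conjCochains_ofBilin (p : V' →ₗ[K] V) (q : W →ₗ[K] W') (D : V →ₗ[K] V →ₗ[K] W) :
    conjCochains p q (ofBilin D) = ofBilin ((D.compl₁₂ p p).compr₂ q) := by
  rw [conjCochains, ofBilin, ofBilin, DirectSum.lmap_lof]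
  rfl

theorem gerstenhaber_lof_lof {m n : ℕ} (f : Cochain K V V m) (g : Cochain K V V n) :
    gerstenhaber (DirectSum.lof K ℕ (fun k => Cochain K V V k) m f)
        (DirectSum.lof K ℕ (fun k => Cochain K V V k) n g) =
      DirectSum.lof K ℕ (fun k => Cochain K V V k) (m + n) (circ m n f g) -
        (-1 : K) ^ (m * n) •
          DirectSum.lof K ℕ (fun k => Cochain K V V k) (n + m) (circ n m g f) := by
  simp [gerstenhaber, circL, circOpL, DirectSum.toModule_lof, sub_eq_add_neg]

/-- The commutator `[D, f] : (x, y) ↦ D (f x) y + D x (f y) - f (D x y)`, that is, the Gerstenhaber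
bracket of a bilinear and a linear map; it measures how far `f` is from being a derivation of the
product `D`. -/
def bilinBracket (D : V →ₗ[K] V →ₗ[K] V) (f : V →ₗ[K] V) : V →ₗ[K] V →ₗ[K] V :=
  D.compl₁₂ f LinearMap.id + D.compl₁₂ LinearMap.id f - D.compr₂ f

theorem bilinBracket_apply (D : V →ₗ[K] V →ₗ[K] V) (f : V →ₗ[K] V) (x y : V) :
    bilinBracket D f x y = D (f x) y + D x (f y) - f (D x y) := rfl

theorem bilinBracket_right_comm (D : V →ₗ[K] V →ₗ[K] V) {f g : Module.End K V}
    (hfg : Commute f g) :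
    bilinBracket (bilinBracket D f) g = bilinBracket (bilinBracket D g) f := by
  have hfg_apply (x : V) : f (g x) = g (f x) := LinearMap.congr_fun hfg x
  ext x y
  simp only [bilinBracket_apply, map_add, map_sub, hfg_apply]
  abel

theorem bilinBracket_bilinBracket_self_apply (D : V →ₗ[K] V →ₗ[K] V) {f : Module.End K V}
    (hf : f * f = 0) (x y : V) :
    bilinBracket (bilinBracket D f) f x y =
      (2 : K) • (D (f x) (f y) - f (D (f x) y + D x (f y))) := by
  have hf_apply (z : V) : f (f z) = 0 := LinearMap.congr_fun hf z
  simp only [bilinBracket_apply, map_add, map_sub, map_zero, LinearMap.zero_apply, hf_apply]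
  module

theorem bilinBracket_bilinBracket_bilinBracket_self_apply (D : V →ₗ[K] V →ₗ[K] V)
    {f : Module.End K V} (hf : f * f = 0) (x y : V) :
    bilinBracket (bilinBracket (bilinBracket D f) f) f x y = (6 : K) • -f (D (f x) (f y)) := by
  have hf_apply (z : V) : f (f z) = 0 := LinearMap.congr_fun hf z
  rw [bilinBracket_apply]
  simp only [bilinBracket_bilinBracket_self_apply D hf, map_smul, map_add, map_sub, map_zero,
    LinearMap.zero_apply, hf_apply]
  module

theorem circ_bilinCochain_ofSubsingleton (D : V →ₗ[K] V →ₗ[K] V) (f : V →ₗ[K] V) :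
    circ 1 0 (bilinCochain D) (MultilinearMap.ofSubsingleton K V V (0 : Fin 1) f) =
      bilinCochain (D.compl₁₂ f LinearMap.id + D.compl₁₂ LinearMap.id f) := by
  ext x
  simp [circ, insertAt, bilinCochain, window, contract, Fin.sum_univ_two]

theorem circ_ofSubsingleton_bilinCochain (D : V →ₗ[K] V →ₗ[K] V) (f : V →ₗ[K] V) :
    circ 0 1 (MultilinearMap.ofSubsingleton K V V (0 : Fin 1) f) (bilinCochain D) =
      bilinCochain (D.compr₂ f) := by
  ext x
  simp [circ, insertAt, bilinCochain, window, contract]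

theorem gerstenhaber_ofBilin_ofLinear (D : V →ₗ[K] V →ₗ[K] V) (f : V →ₗ[K] V) :
    gerstenhaber (ofBilin D) (ofLinear f) = ofBilin (bilinBracket D f) := by
  rw [ofBilin, ofLinear, gerstenhaber_lof_lof, circ_bilinCochain_ofSubsingleton,
    circ_ofSubsingleton_bilinCochain, bilinBracket, ofBilin_sub, mul_zero, pow_zero, one_smul]
  rfl

end Cochains

namespace QuasiTwilled

variable {K 𝒜 : Type*} [Field K] [NonUnitalRing 𝒜] [Module K 𝒜] (T : QuasiTwilled K 𝒜)

@[simp] theorem pr_coe (a : T.A) : T.pr a = a := Submodule.projectionOnto_apply_left _ a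

@[simp] theorem pr_coe' (a : T.A') : T.pr a = 0 := Submodule.projectionOnto_apply_right _ a

@[simp] theorem pr'_coe' (a : T.A') : T.pr' a = a := Submodule.projectionOnto_apply_left _ a

@[simp] theorem pr'_coe (a : T.A) : T.pr' a = 0 := Submodule.projectionOnto_apply_right _ a

/-- The extension by zero of a linear map `A' → A` to `𝒜`. -/
def extend (f : T.A' →ₗ[K] T.A) : Module.End K 𝒜 := T.A.subtype ∘ₗ f ∘ₗ T.pr'

@[simp] theorem extend_apply (f : T.A' →ₗ[K] T.A) (x : 𝒜) : T.extend f x = f (T.pr' x) := rfl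

theorem extend_mul_extend (f g : T.A' →ₗ[K] T.A) : T.extend f * T.extend g = 0 := by
  ext x
  simp

theorem lift_ofLinear (f : T.A' →ₗ[K] T.A) : T.lift (ofLinear f) = ofLinear (T.extend f) :=
  conjCochains_ofLinear _ _ f

theorem iteratedBracket_succ_apply (k : ℕ) (Δ : Cochains K 𝒜 𝒜)
    (x : Fin (k + 1) → Cochains K T.A' T.A) : T.iteratedBracket (k + 1) Δ x =
      T.iteratedBracket k (gerstenhaber Δ (T.lift (x 0))) (Fin.tail x) := rfl

theorem iteratedBracket_ofBilin_ofLinear {k : ℕ} (D : 𝒜 →ₗ[K] 𝒜 →ₗ[K] 𝒜)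
    (f : Fin k → T.A' →ₗ[K] T.A) :
    T.iteratedBracket k (ofBilin D) (fun i => ofLinear (f i)) =
      ofBilin ((List.ofFn f).foldl (fun E g => bilinBracket E (T.extend g)) D) := by
  induction k generalizing D with
  | zero => rfl
  | succ k ih =>
    rw [iteratedBracket_succ_apply, lift_ofLinear, gerstenhaber_ofBilin_ofLinear,
      List.ofFn_succ, List.foldl_cons]
    exact ih _ _

/-- The extensions `T.extend f` multiply to zero, so bracketing with them in any order gives the
same result. -/
theorem isSymmetricOn_iteratedBracket (k : ℕ) (D : 𝒜 →ₗ[K] 𝒜 →ₗ[K] 𝒜) :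
    IsSymmetricOn (T.iteratedBracket k (ofBilin D)) (Set.range ofLinear) := by
  intro σ v hv
  choose f hf using hv
  obtain rfl : (fun i => ofLinear (f i)) = v := funext hf
  have bracket_right_comm : RightCommutative fun E (g : T.A' →ₗ[K] T.A) =>
      bilinBracket E (T.extend g) :=
    ⟨fun E g h => bilinBracket_right_comm E
      ((T.extend_mul_extend g h).trans (T.extend_mul_extend h g).symm)⟩
  rw [iteratedBracket_ofBilin_ofLinear, ← (σ.ofFn_comp_perm f).foldl_eq]
  exact T.iteratedBracket_ofBilin_ofLinear D (f ∘ σ)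

variable [IsScalarTower K 𝒜 𝒜] [SMulCommClass K 𝒜 𝒜]

/-- The part `Δ_k` of the multiplication, extended by zero to `𝒜`, for which
`l_k (f_1, …, f_k) = [⋯[[Δ_k, f_1], f_2], ⋯, f_k]`. -/
def bracketPart : ℕ → 𝒜 →ₗ[K] 𝒜 →ₗ[K] 𝒜
  | 1 => (T.ξ.compl₁₂ T.pr T.pr').compr₂ T.A.subtype +
      (T.η.compl₁₂ T.pr' T.pr).compr₂ T.A.subtype + (T.β.compl₁₂ T.pr' T.pr').compr₂ T.A'.subtype
  | 2 => (T.π.compl₁₂ T.pr T.pr).compr₂ T.A.subtype +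
      (T.ρ.compl₁₂ T.pr T.pr').compr₂ T.A'.subtype + (T.μ.compl₁₂ T.pr' T.pr).compr₂ T.A'.subtype
  | 3 => (T.θ.compl₁₂ T.pr T.pr).compr₂ T.A'.subtype
  | _ => 0

theorem l_eq_proj_iteratedBracket (k : ℕ) :
    T.l k = T.proj.compMultilinearMap (T.iteratedBracket k (ofBilin (T.bracketPart k))) := by
  match k with
  | 1 => rw [bracketPart, ofBilin_add, ofBilin_add]; rfl
  | 2 => rw [bracketPart, ofBilin_add, ofBilin_add]; rfl
  | 3 => rfl
  | 0 | k + 4 => ext; simp [l, bracketPart, ofBilin_zero]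

theorem l_eq_zero {k : ℕ} (hk : 3 < k) : T.l k = 0 := by
  obtain ⟨k, rfl⟩ := Nat.exists_eq_add_of_le' hk
  rfl

theorem isSymmetricOn_l (k : ℕ) : IsSymmetricOn (T.l k) (Set.range ofLinear) := by
  intro σ v hv
  rw [l_eq_proj_iteratedBracket]
  exact congrArg T.proj (T.isSymmetricOn_iteratedBracket k _ σ v hv)

/-- The part of degree `k` in `B` of the defect
`π (Bu, Bv) + ξ (Bu, v) + η (u, Bv) - B (β (u, v) + ρ (Bu, v) + μ (u, Bv) + θ (Bu, Bv))`. -/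
def deformationDefect (B : T.A' →ₗ[K] T.A) : ℕ → T.A' →ₗ[K] T.A' →ₗ[K] T.A
  | 1 => T.ξ.compl₁₂ B LinearMap.id + T.η.compl₁₂ LinearMap.id B - T.β.compr₂ B
  | 2 => T.π.compl₁₂ B B - (T.ρ.compl₁₂ B LinearMap.id + T.μ.compl₁₂ LinearMap.id B).compr₂ B
  | 3 => -(T.θ.compl₁₂ B B).compr₂ B
  | _ => 0

theorem isLeftDeformationMap_iff_deformationDefect (B : T.A' →ₗ[K] T.A) :
    T.IsLeftDeformationMap B ↔ ∑ k ∈ Finset.range 4, T.deformationDefect B k = 0 := by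
  simp only [LinearMap.ext_iff₂, IsLeftDeformationMap]
  refine forall₂_congr fun u v => ?_
  rw [← sub_eq_zero]
  refine Eq.congr_left ?_
  simp only [Finset.sum_range_succ, Finset.range_one, Finset.sum_singleton, deformationDefect,
    zero_add, LinearMap.add_apply, LinearMap.sub_apply, LinearMap.neg_apply,
    LinearMap.compl₁₂_apply, LinearMap.compr₂_apply, LinearMap.id_apply, map_add]
  abel

theorem l_ofLinear {k : ℕ} (f : Fin k → T.A' →ₗ[K] T.A) :
    T.l k (fun i => ofLinear (f i)) = ofBilin
      ((((List.ofFn f).foldl (fun E g => bilinBracket E (T.extend g)) (T.bracketPart k)).compl₁₂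
        T.A'.subtype T.A'.subtype).compr₂ T.pr) := by
  rw [l_eq_proj_iteratedBracket, LinearMap.compMultilinearMap_apply,
    iteratedBracket_ofBilin_ofLinear, proj, conjCochains_ofBilin]

theorem l_ofLinear_self (B : T.A' →ₗ[K] T.A) (k : ℕ) :
    T.l k (fun _ => ofLinear B) = (k.factorial : K) • ofBilin (T.deformationDefect B k) := by
  match k with
  | 0 | k + 4 => simp [l, deformationDefect, ofBilin_zero]
  | 1 =>
    rw [T.l_ofLinear fun _ => B, ← ofBilin_smul]
    congr 1
    ext u v
    simp [deformationDefect, bracketPart, bilinBracket_apply]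
  | 2 =>
    rw [T.l_ofLinear fun _ => B, ← ofBilin_smul]
    congr 1
    ext u v
    simp [deformationDefect, bracketPart, Nat.factorial,
      bilinBracket_bilinBracket_self_apply _ (T.extend_mul_extend B B)]
  | 3 =>
    rw [T.l_ofLinear fun _ => B, ← ofBilin_smul]
    congr 1
    ext u v
    simp [deformationDefect, bracketPart, Nat.factorial,
      bilinBracket_bilinBracket_bilinBracket_self_apply _ (T.extend_mul_extend B B)]

theorem curvature_l_ofLinear (h6 : (6 : K) ≠ 0) (B : T.A' →ₗ[K] T.A) :
    T.l.curvature (ofLinear B) = ofBilin (∑ k ∈ Finset.range 4, T.deformationDefect B k) := by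
  have inv_factorial_smul_l {k : ℕ} (hk : k ≤ 3) :
      (k.factorial : K)⁻¹ • T.l k (fun _ => ofLinear B) = ofBilin (T.deformationDefect B k) := by
    rw [l_ofLinear_self, inv_smul_smul₀ (cast_factorial_ne_zero_of_le hk h6)]
  rw [Operations.curvature_eq_sum fun _ => T.l_eq_zero, ofBilin_sum]
  exact Finset.sum_congr rfl fun k hk => inv_factorial_smul_l (Finset.mem_range_succ_iff.1 hk)

theorem isLeftDeformationMap_iff_curvature_eq_zero (h6 : (6 : K) ≠ 0) (B : T.A' →ₗ[K] T.A) :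
    T.IsLeftDeformationMap B ↔ T.l.curvature (ofLinear B) = 0 := by
  rw [isLeftDeformationMap_iff_deformationDefect, curvature_l_ofLinear T h6, ofBilin_eq_zero_iff]

end QuasiTwilled

end

/-- In characteristic `p ≥ 5` the coefficients `1 / k!` with `k ≥ p` have the junk value `0`; they
only multiply operations that vanish. -/
theorem mainTheorem8_general {K 𝒜 : Type*} [Field K] [NonUnitalRing 𝒜] [Module K 𝒜]
    [IsScalarTower K 𝒜 𝒜] [SMulCommClass K 𝒜 𝒜] (h6 : (6 : K) ≠ 0) (T : QuasiTwilled K 𝒜)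
    (B : T.A' →ₗ[K] T.A) (hB : T.IsLeftDeformationMap B) (B' : T.A' →ₗ[K] T.A) :
    T.IsLeftDeformationMap (B + B') ↔
      IsMaurerCartan (twist T.l (ofLinear B)) (ofLinear B') := by
  have curvature_B : T.l.curvature (ofLinear B) = 0 :=
    (T.isLeftDeformationMap_iff_curvature_eq_zero h6 B).1 hB
  calc T.IsLeftDeformationMap (B + B')
      ↔ T.l.curvature (ofLinear B + ofLinear B') = 0 := by
        rw [T.isLeftDeformationMap_iff_curvature_eq_zero h6, ofLinear_add]
    _ ↔ (twist T.l (ofLinear B)).curvature (ofLinear B') = 0 := by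
        rw [Operations.curvature_add T.isSymmetricOn_l (fun _ => T.l_eq_zero) h6 ⟨B, rfl⟩ ⟨B', rfl⟩,
          curvature_B, zero_add]
    _ ↔ IsMaurerCartan (twist T.l (ofLinear B)) (ofLinear B') :=
        (and_iff_right ⟨_, rfl⟩).symm

theorem mainTheorem8 {K 𝒜 : Type*} [Field K] [CharZero K] [NonUnitalRing 𝒜] [Module K 𝒜]
    [IsScalarTower K 𝒜 𝒜] [SMulCommClass K 𝒜 𝒜] (T : QuasiTwilled K 𝒜)
    (B : T.A' →ₗ[K] T.A) (hB : T.IsLeftDeformationMap B) (B' : T.A' →ₗ[K] T.A) :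
    T.IsLeftDeformationMap (B + B') ↔
      IsMaurerCartan (twist T.l (ofLinear B)) (ofLinear B') :=
  mainTheorem8_general (by norm_num) T B hB B'
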